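/- For $\xi\in\mathbb{R}$ let $\operatorname{Erf}(\xi)=\int_0^\xi e^{-x^2}\,dx$, and for an integer $d\ge 1$ let \[ V_d=\int_{[0,1]^d}\int_{[0,1]^d}\frac{dy\,dx}{\|x-y\|_2}\in[0,\infty] \] be the self-interaction of the unit $d$-cube. (i) For all $d\ge 1$, \[ V_d=\frac{2}{\sqrt\pi}\int_0^\infty\left(\frac{2\operatorname{Erf}(\sigma)}{\sigma}+\frac{e^{-\sigma^2}-1}{\sigma^2}\right)^{d}d\sigma . \] For $d=1$ both sides are $+\infty$; for $d\ge 2$ both sides are finite, and the integrand on the right is integrable on $(0,\infty)$. (ii) For $d=4$, the function $\sigma^{-1}e^{-\sigma^2}\operatorname{Erf}(\sigma)^3$ is integrable on $(0,\infty)$ and \[ \begin{aligned} V_4={}&-\frac{152}{315}+\frac{68\sqrt2}{105}-\frac{16\sqrt3}{35}-\frac{16\log 2}{5}+\frac{2\log 3}{5} +\frac45\log(1+\sqrt2)+\frac{32}{5}\log(1+\sqrt3)\\ &-\frac{8\pi}{15}-\frac{8\sqrt2}{5}\arctan\frac{1}{2\sqrt2} -\frac{16}{3}\cdot\frac{2}{\sqrt\pi}\int_0^\infty\sigma^{-1}e^{-\sigma^2}\operatorname{Erf}(\sigma)^3\,d\sigma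 . \end{aligned} \] -/

import Mathlib

open MeasureTheory Set
open scoped ENNReal

noncomputable section

/-- The error function normalized as the odd primitive of the Gaussian `exp (-x ^ 2)`
(without the factor `2 / √π`). -/
def Erf (ξ : ℝ) : ℝ := ∫ x in (0 : ℝ)..ξ, Real.exp (-x ^ 2)

/-- The unit cube `[0,1]^d` in Euclidean space `ℝ^d`. -/
def unitCube (d : ℕ) : Set (EuclideanSpace ℝ (Fin d)) :=
  {x | ∀ i, x i ∈ Icc (0 : ℝ) 1}

/-- The Newtonian self-interaction `V_d = ∫_{[0,1]^d} ∫_{[0,1]^d} dy dx / ‖x - y‖₂` of the unit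
`d`-cube. The integrand is nonnegative, so the integral is taken with values in `[0, ∞]`; the
integrand is `∞` on the diagonal. -/
def selfInteraction (d : ℕ) : ℝ≥0∞ :=
  ∫⁻ x in unitCube d, ∫⁻ y in unitCube d, (ENNReal.ofReal ‖x - y‖)⁻¹

end

open Filter Topology

/-! ### The error function -/

/-! The Gaussian integral gives `1/r = (2/√π) ∫₀^∞ exp(-σ²r²) dσ`. With `r = ‖x - y‖` the Gaussian
factors over the coordinates, so by Tonelli the integral over both cubes is the `d`-th power of a
one-dimensional integral, which is `intervalKernel`. This kernel is bounded near `0` and of order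
`1/σ` at infinity, so its `d`-th power is integrable exactly when `d ≥ 2`.

For `d = 4`, integration by parts removes the high powers of `σ⁻¹` from the kernel's fourth power.
The boundary terms vanish at both ends, leaving `kernelRemainder`. This is certified backwards: the
sum of `boundaryTerms` is differentiated and compared (`sum_erfMonomialDeriv_boundaryTerms`). Apart
from the irreducible integral of `σ⁻¹ exp(-σ²) Erf³`, the remaining integrals are elementary. The
main tool is `Erf σ = σ ∫₀¹ exp(-(tσ)²) dt`, which absorbs an `Erf` into a Gaussian at the cost of
an outer integral over `t`. -/

theorem hasDerivAt_Erf (ξ : ℝ) : HasDerivAt Erf (Real.exp (-ξ ^ 2)) ξ :=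
  (by fun_prop : Continuous fun x : ℝ => Real.exp (-x ^ 2)).integral_hasStrictDerivAt 0 ξ
    |>.hasDerivAt

theorem continuous_Erf : Continuous Erf :=
  continuous_iff_continuousAt.2 fun ξ => (hasDerivAt_Erf ξ).continuousAt

@[simp] theorem Erf_zero : Erf 0 = 0 := by simp [Erf]

theorem monotone_Erf : Monotone Erf :=
  monotone_of_hasDerivAt_nonneg hasDerivAt_Erf fun _ => (Real.exp_pos _).le

theorem Erf_nonneg {ξ : ℝ} (h : 0 ≤ ξ) : 0 ≤ Erf ξ := by
  simpa using monotone_Erf h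

theorem tendsto_Erf_atTop : Tendsto Erf atTop (𝓝 (√Real.pi / 2)) := by
  have h := intervalIntegral_tendsto_integral_Ioi (μ := volume) (f := fun x : ℝ => Real.exp (-x ^ 2))
    0 (by simpa using (integrable_exp_neg_mul_sq one_pos).integrableOn) tendsto_id
  have h2 := integral_gaussian_Ioi 1
  simp only [neg_mul, one_mul, div_one] at h2
  rwa [h2] at h

theorem Erf_le (ξ : ℝ) : Erf ξ ≤ √Real.pi / 2 :=
  monotone_Erf.ge_of_tendsto tendsto_Erf_atTop ξ

theorem Erf_le_one (ξ : ℝ) : Erf ξ ≤ 1 := by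
  refine (Erf_le ξ).trans ?_
  have : √Real.pi ≤ 2 := Real.sqrt_le_iff.2 ⟨by norm_num, by linarith [Real.pi_le_four]⟩
  linarith

theorem Erf_eq_mul_integral (σ : ℝ) : Erf σ = σ * ∫ t in (0 : ℝ)..1, Real.exp (-(t * σ) ^ 2) := by
  rcases eq_or_ne σ 0 with rfl | h
  · simp
  · rw [intervalIntegral.integral_comp_mul_right (fun x => Real.exp (-x ^ 2)) h]
    simp [Erf, h]

theorem Erf_le_self {ξ : ℝ} (h : 0 ≤ ξ) : Erf ξ ≤ ξ := by
  have := intervalIntegral.integral_mono_on h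
    ((by fun_prop : Continuous fun x : ℝ => Real.exp (-x ^ 2)).intervalIntegrable 0 ξ)
    ((continuous_const (y := (1 : ℝ))).intervalIntegrable (μ := volume) 0 ξ)
    (fun x _ => Real.exp_le_one_iff.2 (by nlinarith))
  simpa [Erf] using this

/-- Integrate `1 - x² ≤ exp(-x²)` over `[0,1]`. This feeds the lower bound on the kernel behind the
divergence for `d = 1`. -/
theorem two_thirds_le_Erf_one : 2 / 3 ≤ Erf 1 := by
  have := intervalIntegral.integral_mono_on zero_le_one
    ((by fun_prop : Continuous fun x : ℝ => 1 - x ^ 2).intervalIntegrable (μ := volume) 0 1)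
    ((by fun_prop : Continuous fun x : ℝ => Real.exp (-x ^ 2)).intervalIntegrable 0 1)
    (fun x _ => by linarith [Real.add_one_le_exp (-x ^ 2)])
  rw [intervalIntegral.integral_sub (by simp) ((continuous_pow 2).intervalIntegrable _ _)] at this
  norm_num at this
  simpa [Erf] using this

/-! ### The Gaussian self-interaction of the unit interval -/

/-- The Gaussian self-interaction `∫∫ exp (-σ² (x - y)²)` of the unit interval, in closed form. -/
noncomputable def intervalKernel (σ : ℝ) : ℝ := 2 * Erf σ / σ + (Real.exp (-σ ^ 2) - 1) / σ ^ 2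

theorem integral_exp_neg_sq_sub {σ : ℝ} (hσ : σ ≠ 0) (x : ℝ) :
    ∫ y in (0 : ℝ)..1, Real.exp (-(σ * (x - y)) ^ 2) = (Erf (σ * x) - Erf (σ * (x - 1))) / σ := by
  have h : ∀ y ∈ uIcc (0 : ℝ) 1, HasDerivAt (fun y => -Erf (σ * (x - y)) / σ)
      (Real.exp (-(σ * (x - y)) ^ 2)) y := by
    intro y _
    have h1 : HasDerivAt (fun y => σ * (x - y)) (σ * -1) y :=
      ((hasDerivAt_id y).const_sub x).const_mul σ
    refine (((hasDerivAt_Erf _).comp y h1).neg.div_const σ).congr_deriv ?_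
    field_simp
  rw [intervalIntegral.integral_eq_sub_of_hasDerivAt h
    ((by fun_prop : Continuous _).intervalIntegrable _ _)]
  simp only [sub_zero]
  ring

theorem integral_integral_exp_neg_sq_sub {σ : ℝ} (hσ : σ ≠ 0) :
    ∫ x in (0 : ℝ)..1, ∫ y in (0 : ℝ)..1, Real.exp (-(σ * (x - y)) ^ 2) = intervalKernel σ := by
  simp only [integral_exp_neg_sq_sub hσ]
  -- Integration by parts gives this antiderivative of `Erf`.
  have hG (u : ℝ) : HasDerivAt (fun u => u * Erf u + Real.exp (-u ^ 2) / 2) (Erf u) u := by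
    have h1 : HasDerivAt (fun u : ℝ => Real.exp (-u ^ 2)) (Real.exp (-u ^ 2) * -(2 * u)) u := by
      simpa using ((hasDerivAt_pow 2 u).neg).exp
    refine (((hasDerivAt_id u).mul (hasDerivAt_Erf u)).add (h1.div_const 2)).congr_deriv ?_
    simp only [id]
    ring
  have h : ∀ x ∈ uIcc (0 : ℝ) 1, HasDerivAt
      (fun x => ((σ * x * Erf (σ * x) + Real.exp (-(σ * x) ^ 2) / 2) -
        (σ * (x - 1) * Erf (σ * (x - 1)) + Real.exp (-(σ * (x - 1)) ^ 2) / 2)) / σ ^ 2)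
      ((Erf (σ * x) - Erf (σ * (x - 1))) / σ) x := by
    intro x _
    have h1 : HasDerivAt (fun y => σ * y) (σ * 1) x := (hasDerivAt_id x).const_mul σ
    have h2 : HasDerivAt (fun y => σ * (y - 1)) (σ * 1) x :=
      ((hasDerivAt_id x).sub_const 1).const_mul σ
    refine ((((hG _).comp x h1).sub ((hG _).comp x h2)).div_const (σ ^ 2)).congr_deriv ?_
    field_simp
  have hc := continuous_Erf
  rw [intervalIntegral.integral_eq_sub_of_hasDerivAt h
    ((by fun_prop : Continuous _).intervalIntegrable _ _)]
  have hodd : Erf (-σ) = -Erf σ := by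
    rw [Erf_eq_mul_integral (-σ), Erf_eq_mul_integral σ]
    simp
  simp only [intervalKernel, mul_one, sub_self, mul_zero, zero_sub, mul_neg, hodd, Erf_zero]
  norm_num
  field_simp
  ring

theorem intervalKernel_nonneg {σ : ℝ} (hσ : σ ≠ 0) : 0 ≤ intervalKernel σ := by
  rw [← integral_integral_exp_neg_sq_sub hσ]
  exact intervalIntegral.integral_nonneg zero_le_one fun x _ =>
    intervalIntegral.integral_nonneg zero_le_one fun y _ => (Real.exp_pos _).le

theorem intervalKernel_le_div {σ : ℝ} (hσ : 0 < σ) : intervalKernel σ ≤ 2 / σ := by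
  have h1 : (Real.exp (-σ ^ 2) - 1) / σ ^ 2 ≤ 0 := by
    refine div_nonpos_of_nonpos_of_nonneg ?_ (by positivity)
    linarith [Real.exp_le_one_iff.2 (by nlinarith : -σ ^ 2 ≤ 0)]
  have h2 : 2 * Erf σ / σ ≤ 2 / σ := by gcongr; linarith [Erf_le_one σ]
  unfold intervalKernel
  linarith

theorem intervalKernel_le_two {σ : ℝ} (hσ : 0 < σ) : intervalKernel σ ≤ 2 := by
  have h1 : (Real.exp (-σ ^ 2) - 1) / σ ^ 2 ≤ 0 := by
    refine div_nonpos_of_nonpos_of_nonneg ?_ (by positivity)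
    linarith [Real.exp_le_one_iff.2 (by nlinarith : -σ ^ 2 ≤ 0)]
  have h2 : 2 * Erf σ / σ ≤ 2 := by
    rw [div_le_iff₀ hσ]; linarith [Erf_le_self hσ.le]
  unfold intervalKernel
  linarith

theorem inv_div_two_le_intervalKernel {σ : ℝ} (hσ : 2 ≤ σ) : σ⁻¹ / 2 ≤ intervalKernel σ := by
  have hp : 0 < σ := by linarith
  have h1 : 2 / 3 ≤ Erf σ := two_thirds_le_Erf_one.trans (monotone_Erf (by linarith))
  have h2 := Real.exp_pos (-σ ^ 2)
  have h3 : intervalKernel σ - σ⁻¹ / 2 =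
      ((2 * Erf σ - 1 / 2) * σ + (Real.exp (-σ ^ 2) - 1)) / σ ^ 2 := by
    unfold intervalKernel
    field_simp
    ring
  have : 0 ≤ intervalKernel σ - σ⁻¹ / 2 := by
    rw [h3]
    apply div_nonneg _ (by positivity)
    nlinarith
  linarith

theorem continuousOn_intervalKernel : ContinuousOn intervalKernel (Ioi 0) := by
  have hc := continuous_Erf.continuousOn (s := Ioi (0 : ℝ))
  unfold intervalKernel
  refine ContinuousOn.add (ContinuousOn.div (by fun_prop) (by fun_prop) ?_)
    (ContinuousOn.div (by fun_prop) (by fun_prop) ?_)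
  · intro x hx; exact (ne_of_gt hx)
  · intro x hx; exact pow_ne_zero _ (ne_of_gt hx)

/-- Compare with the constant `2 ^ d` on `(0,1]` and with `(2/σ) ^ d` on `(1,∞)`; only the second
needs `d ≥ 2`. -/
theorem integrableOn_intervalKernel_pow {d : ℕ} (hd : 2 ≤ d) :
    IntegrableOn (fun σ => intervalKernel σ ^ d) (Ioi 0) := by
  have hm : AEStronglyMeasurable (fun σ => intervalKernel σ ^ d) (volume.restrict (Ioi 0)) :=
    (continuousOn_intervalKernel.pow d).aestronglyMeasurable measurableSet_Ioi
  rw [← Ioc_union_Ioi_eq_Ioi (zero_le_one' ℝ)]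
  refine IntegrableOn.union ?_ ?_
  · refine Integrable.mono' (integrable_const ((2 : ℝ) ^ d))
      (hm.mono_set Ioc_subset_Ioi_self) ?_
    filter_upwards [ae_restrict_mem measurableSet_Ioc] with σ hσ
    have h0 := intervalKernel_nonneg hσ.1.ne'
    rw [Real.norm_of_nonneg (by positivity)]
    exact pow_le_pow_left₀ h0 (intervalKernel_le_two hσ.1) d
  · have hd' : (1 : ℝ) < d := by exact_mod_cast hd
    have hi : IntegrableOn (fun σ : ℝ => 2 ^ d * σ ^ (-(d : ℝ))) (Ioi 1) :=
      (integrableOn_Ioi_rpow_of_lt (by linarith) one_pos).const_mul _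
    refine Integrable.mono' hi
      (hm.mono_set (Ioi_subset_Ioi zero_le_one)) ?_
    filter_upwards [ae_restrict_mem measurableSet_Ioi] with σ hσ
    have hp : 0 < σ := one_pos.trans hσ
    have h0 := intervalKernel_nonneg hp.ne'
    rw [Real.norm_of_nonneg (by positivity), Real.rpow_neg hp.le, Real.rpow_natCast,
      ← div_eq_mul_inv, ← div_pow]
    exact pow_le_pow_left₀ h0 (intervalKernel_le_div hp) d

/-! ### The Gaussian representation of the self-interaction -/

theorem inv_ofReal_eq_lintegral_gaussian {r : ℝ} (hr : 0 ≤ r) :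
    (ENNReal.ofReal r)⁻¹ =
      ∫⁻ σ in Ioi (0 : ℝ), ENNReal.ofReal (2 / √Real.pi * Real.exp (-σ ^ 2 * r ^ 2)) := by
  have hc : 0 < 2 / √Real.pi := by positivity
  rcases hr.eq_or_lt with rfl | hr
  -- On the diagonal both sides are `∞`: a positive constant is integrated over a half-line.
  · simp [ENNReal.mul_top, hc]
  · have hi : IntegrableOn (fun σ : ℝ => Real.exp (-σ ^ 2 * r ^ 2)) (Ioi 0) := by
      have := (integrable_exp_neg_mul_sq (pow_pos hr 2)).integrableOn (s := Ioi 0)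
      refine this.congr_fun (fun σ _ => ?_) measurableSet_Ioi
      ring_nf
    rw [← ofReal_integral_eq_lintegral_ofReal (hi.const_mul _) (ae_of_all _ fun σ => by positivity),
      integral_const_mul, ← ENNReal.ofReal_inv_of_pos hr]
    congr 1
    have h := integral_gaussian_Ioi (r ^ 2)
    have h' : ∫ σ in Ioi (0 : ℝ), Real.exp (-σ ^ 2 * r ^ 2) = √(Real.pi / r ^ 2) / 2 := by
      rw [← h]; congr 1; ext σ; ring_nf
    rw [h', Real.sqrt_div Real.pi_pos.le, Real.sqrt_sq hr.le]
    field_simp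

theorem lintegral_pi_ofReal_prod {α : Type*} [MeasurableSpace α] (μ : Measure α) [SigmaFinite μ]
    {d : ℕ} (f : Fin d → α → ℝ) (hf : ∀ i, Integrable (f i) μ) (h0 : ∀ i x, 0 ≤ f i x) :
    ∫⁻ x, ENNReal.ofReal (∏ i, f i (x i)) ∂Measure.pi (fun _ : Fin d => μ) =
      ENNReal.ofReal (∏ i, ∫ x, f i x ∂μ) := by
  rw [← integral_fin_nat_prod_eq_prod, ofReal_integral_eq_lintegral_ofReal]
  · exact Integrable.fin_nat_prod hf
  · exact ae_of_all _ fun x => Finset.prod_nonneg fun i _ => h0 i _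

theorem setLIntegral_unitCube {d : ℕ} (F : EuclideanSpace ℝ (Fin d) → ℝ≥0∞) :
    ∫⁻ x in unitCube d, F x =
      ∫⁻ x, F (WithLp.toLp 2 x) ∂Measure.pi fun _ : Fin d => volume.restrict (Icc (0 : ℝ) 1) := by
  have h := (PiLp.volume_preserving_toLp (Fin d)).setLIntegral_comp_preimage_emb
    (MeasurableEquiv.toLp 2 (Fin d → ℝ)).measurableEmbedding F (unitCube d)
  rw [← h, ← Measure.restrict_pi_pi, volume_pi]
  congr 2
  ext x
  simp [unitCube, Pi.le_def, forall_and]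

theorem selfInteraction_eq_lintegral (d : ℕ) :
    selfInteraction d =
      ∫⁻ σ in Ioi (0 : ℝ), ENNReal.ofReal (2 / √Real.pi * intervalKernel σ ^ d) := by
  set μ : Measure ℝ := volume.restrict (Icc (0 : ℝ) 1) with hμ
  set π := Measure.pi fun _ : Fin d => μ
  have h1 : selfInteraction d = ∫⁻ x, ∫⁻ y, (∫⁻ σ in Ioi (0 : ℝ),
      ENNReal.ofReal (2 / √Real.pi * ∏ i, Real.exp (-(σ * (x i - y i)) ^ 2))) ∂π ∂π := by
    simp only [selfInteraction, setLIntegral_unitCube, inv_ofReal_eq_lintegral_gaussian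
      (norm_nonneg _)]
    congr! 9 with x y σ
    rw [← Real.exp_sum, EuclideanSpace.norm_sq_eq]
    congr 1
    simp [Finset.mul_sum, mul_pow]
  have hm : Measurable fun p : (Fin d → ℝ) × (Fin d → ℝ) × ℝ =>
      ENNReal.ofReal (2 / √Real.pi * ∏ i, Real.exp (-(p.2.2 * (p.1 i - p.2.1 i)) ^ 2)) := by
    fun_prop
  have h2 (x : Fin d → ℝ) : ∫⁻ y, (∫⁻ σ in Ioi (0 : ℝ),
      ENNReal.ofReal (2 / √Real.pi * ∏ i, Real.exp (-(σ * (x i - y i)) ^ 2))) ∂π =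
      ∫⁻ σ in Ioi (0 : ℝ), ∫⁻ y,
      ENNReal.ofReal (2 / √Real.pi * ∏ i, Real.exp (-(σ * (x i - y i)) ^ 2)) ∂π := by
    apply lintegral_lintegral_swap
    exact (hm.comp (measurable_prodMk_left (x := x))).aemeasurable
  have hm' : Measurable fun p : (Fin d → ℝ) × ℝ => ∫⁻ y,
      ENNReal.ofReal (2 / √Real.pi * ∏ i, Real.exp (-(p.2 * (p.1 i - y i)) ^ 2)) ∂π := by
    apply Measurable.lintegral_prod_right'
      (f := fun q : ((Fin d → ℝ) × ℝ) × (Fin d → ℝ) =>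
        ENNReal.ofReal (2 / √Real.pi * ∏ i, Real.exp (-(q.1.2 * (q.1.1 i - q.2 i)) ^ 2)))
    fun_prop
  rw [h1]
  simp only [h2]
  rw [lintegral_lintegral_swap hm'.aemeasurable]
  refine setLIntegral_congr_fun measurableSet_Ioi fun σ hσ => ?_
  have hσ' : σ ≠ 0 := ne_of_gt hσ
  have hconv (F : ℝ → ℝ) : ∫ x, F x ∂μ = ∫ x in (0 : ℝ)..1, F x := by
    rw [intervalIntegral.integral_of_le zero_le_one, hμ, integral_Icc_eq_integral_Ioc]
  have hint (F : ℝ → ℝ) (hF : Continuous F) : Integrable F μ :=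
    hF.continuousOn.integrableOn_compact isCompact_Icc
  have hc := continuous_Erf
  have hc0 : 0 ≤ 2 / √Real.pi := by positivity
  have h3 (x : Fin d → ℝ) : ∫⁻ y,
      ENNReal.ofReal (2 / √Real.pi * ∏ i, Real.exp (-(σ * (x i - y i)) ^ 2)) ∂π =
      ENNReal.ofReal (2 / √Real.pi) *
        ENNReal.ofReal (∏ i, ∫ y in (0 : ℝ)..1, Real.exp (-(σ * (x i - y)) ^ 2)) := by
    simp only [ENNReal.ofReal_mul hc0]
    rw [lintegral_const_mul' _ _ ENNReal.ofReal_ne_top,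
      lintegral_pi_ofReal_prod μ (fun i y => Real.exp (-(σ * (x i - y)) ^ 2))
        (fun i => hint _ (by fun_prop)) (fun i y => (Real.exp_pos _).le)]
    simp only [hconv]
  simp only [h3]
  rw [lintegral_const_mul' _ _ ENNReal.ofReal_ne_top,
    lintegral_pi_ofReal_prod μ (fun i x => ∫ y in (0 : ℝ)..1, Real.exp (-(σ * (x - y)) ^ 2))
      (fun i => hint _ (by simp only [integral_exp_neg_sq_sub hσ']; fun_prop))
      (fun i x => intervalIntegral.integral_nonneg zero_le_one fun y _ => (Real.exp_pos _).le)]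
  simp only [hconv, integral_integral_exp_neg_sq_sub hσ', Finset.prod_const, Finset.card_univ,
    Fintype.card_fin]
  rw [← ENNReal.ofReal_mul hc0]

theorem selfInteraction_one : selfInteraction 1 = ∞ := by
  rw [selfInteraction_eq_lintegral]
  -- Finiteness would pass to the smaller integrand `σ⁻¹ / 2` on `(2,∞)`, where `σ⁻¹` is not
  -- integrable.
  by_contra h
  have h2 : ∫⁻ σ in Ioi (2 : ℝ), ENNReal.ofReal (2 / √Real.pi * (σ⁻¹ / 2)) ≠ ∞ := by
    refine ne_top_of_le_ne_top h ?_
    refine (setLIntegral_mono' measurableSet_Ioi fun σ hσ => ?_).trans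
      (lintegral_mono_set (Ioi_subset_Ioi zero_le_two))
    rw [pow_one]
    gcongr
    exact inv_div_two_le_intervalKernel (le_of_lt hσ)
  refine not_integrableOn_Ioi_inv (a := 2) ?_
  have h3 : IntegrableOn (fun σ : ℝ => 2 / √Real.pi * (σ⁻¹ / 2)) (Ioi 2) := by
    refine ⟨by fun_prop, ?_⟩
    rw [hasFiniteIntegral_iff_ofReal]
    · exact h2.lt_top
    · filter_upwards [ae_restrict_mem measurableSet_Ioi] with σ hσ
      have : 0 < σ := two_pos.trans hσ
      simp only [Pi.zero_apply]
      positivity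
  refine IntegrableOn.congr_fun (h3.const_mul (√Real.pi)) (fun σ _ => ?_) measurableSet_Ioi
  field_simp

theorem selfInteraction_eq_ofReal {d : ℕ} (hd : 2 ≤ d) :
    selfInteraction d =
      ENNReal.ofReal (2 / √Real.pi * ∫ σ in Ioi (0 : ℝ), intervalKernel σ ^ d) := by
  rw [selfInteraction_eq_lintegral, ← integral_const_mul, ofReal_integral_eq_lintegral_ofReal
    ((integrableOn_intervalKernel_pow hd).const_mul _)]
  filter_upwards [ae_restrict_mem measurableSet_Ioi] with σ hσ
  have := intervalKernel_nonneg (ne_of_gt hσ : σ ≠ 0)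
  simp only [Pi.zero_apply]
  positivity

theorem toReal_selfInteraction {d : ℕ} (hd : 2 ≤ d) :
    (selfInteraction d).toReal =
      2 / √Real.pi * ∫ σ in Ioi (0 : ℝ), intervalKernel σ ^ d := by
  rw [selfInteraction_eq_ofReal hd, ENNReal.toReal_ofReal]
  refine mul_nonneg (by positivity) (setIntegral_nonneg measurableSet_Ioi fun σ hσ => ?_)
  exact pow_nonneg (intervalKernel_nonneg (ne_of_gt hσ)) d

/-! ### Gaussian integrals of powers of the error function -/

theorem integrableOn_exp_neg_mul_sq {k : ℝ} (hk : 0 < k) :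
    IntegrableOn (fun σ : ℝ => Real.exp (-k * σ ^ 2)) (Ioi 0) :=
  (integrable_exp_neg_mul_sq hk).integrableOn

theorem integrableOn_Ioi_of_le_gaussian {k : ℝ} (hk : 0 < k) {F : ℝ → ℝ}
    (hF : ContinuousOn F (Ioi 0)) (h : ∀ σ > 0, |F σ| ≤ Real.exp (-k * σ ^ 2)) :
    IntegrableOn F (Ioi 0) := by
  refine Integrable.mono' (integrableOn_exp_neg_mul_sq hk)
    (hF.aestronglyMeasurable measurableSet_Ioi) ?_
  filter_upwards [ae_restrict_mem measurableSet_Ioi] with σ hσ using h σ hσ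

theorem abs_inv_mul_Erf_le_one {σ : ℝ} (hσ : 0 < σ) : |σ⁻¹ * Erf σ| ≤ 1 := by
  rw [abs_of_nonneg (mul_nonneg (inv_nonneg.2 hσ.le) (Erf_nonneg hσ.le)), inv_mul_le_iff₀ hσ,
    mul_one]
  exact Erf_le_self hσ.le

theorem abs_Erf_le_one {σ : ℝ} (hσ : 0 < σ) : |Erf σ| ≤ 1 := by
  rw [abs_of_nonneg (Erf_nonneg hσ.le)]
  exact Erf_le_one σ

theorem continuousOn_inv_Ioi : ContinuousOn (fun σ : ℝ => σ⁻¹) (Ioi 0) :=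
  continuousOn_inv₀.mono fun _ h => ne_of_gt h

/-- One factor `Erf σ ≤ σ` cancels the singularity of `σ⁻¹`, hence the exponent `n + 1`. -/
theorem integrableOn_inv_mul_Erf_pow_succ (n : ℕ) {k : ℝ} (hk : 0 < k) :
    IntegrableOn (fun σ => σ⁻¹ * Erf σ ^ (n + 1) * Real.exp (-k * σ ^ 2)) (Ioi 0) := by
  refine integrableOn_Ioi_of_le_gaussian hk ?_ fun σ hσ => ?_
  · have := continuous_Erf
    exact (continuousOn_inv_Ioi.mul (by fun_prop)).mul (by fun_prop)
  · rw [pow_succ', ← mul_assoc, abs_mul, abs_mul, Real.abs_exp, abs_pow]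
    refine mul_le_of_le_one_left (Real.exp_pos _).le (mul_le_one₀ (abs_inv_mul_Erf_le_one hσ)
      (by positivity) (pow_le_one₀ (abs_nonneg _) (abs_Erf_le_one hσ)))

theorem integrableOn_Erf_pow (n : ℕ) {k : ℝ} (hk : 0 < k) :
    IntegrableOn (fun σ => Erf σ ^ n * Real.exp (-k * σ ^ 2)) (Ioi 0) := by
  refine integrableOn_Ioi_of_le_gaussian hk ?_ fun σ hσ => ?_
  · have := continuous_Erf
    fun_prop
  · rw [abs_mul, Real.abs_exp, abs_pow]
    exact mul_le_of_le_one_left (Real.exp_pos _).le (pow_le_one₀ (abs_nonneg _) (abs_Erf_le_one hσ))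

theorem integrableOn_mul_Erf_mul_exp {c : ℝ} (hc : 0 < c) :
    IntegrableOn (fun σ => Erf σ * (σ * Real.exp (-c * σ ^ 2))) (Ioi 0) := by
  refine Integrable.mono' (integrable_mul_exp_neg_mul_sq hc).integrableOn.norm
    (Continuous.aestronglyMeasurable ?_) ?_
  · have := continuous_Erf
    fun_prop
  · filter_upwards [ae_restrict_mem measurableSet_Ioi] with σ hσ
    rw [norm_mul]
    exact mul_le_of_le_one_left (norm_nonneg _) (abs_Erf_le_one hσ)

/-- Fubini applies because the Gaussian factor is at most `1`, so `|w σ|` dominates on the finite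
range of `t`. -/
theorem setIntegral_mul_integral_exp_swap {w : ℝ → ℝ} (hw : IntegrableOn w (Ioi 0)) :
    ∫ σ in Ioi (0 : ℝ), w σ * ∫ t in (0 : ℝ)..1, Real.exp (-(t * σ) ^ 2) =
      ∫ t in (0 : ℝ)..1, ∫ σ in Ioi (0 : ℝ), w σ * Real.exp (-(t * σ) ^ 2) := by
  simp only [intervalIntegral.integral_of_le zero_le_one, ← integral_const_mul]
  apply integral_integral_swap
  refine Integrable.mono' (g := fun p : ℝ × ℝ => ‖w p.1‖ * 1)
    (Integrable.mul_prod hw.norm (integrable_const _)) ?_ (ae_of_all _ fun p => ?_)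
  · exact (hw.aestronglyMeasurable.comp_fst).mul (by fun_prop)
  · simp only [Function.uncurry, norm_mul]
    gcongr
    rw [Real.norm_of_nonneg (Real.exp_pos _).le]
    exact Real.exp_le_one_iff.2 (by nlinarith [sq_nonneg (p.2 * p.1)])

theorem setIntegral_exp_neg_mul_sq {k : ℝ} :
    ∫ σ in Ioi (0 : ℝ), Real.exp (-k * σ ^ 2) = √Real.pi / 2 * (1 / √k) := by
  rw [integral_gaussian_Ioi, Real.sqrt_div Real.pi_pos.le]
  ring

/-- Writing `σ⁻¹ Erf σ` as an average of Gaussians reduces the claim to `∫₀¹ dt / √(k + t²)`. -/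
theorem setIntegral_inv_mul_Erf {k : ℝ} (hk : 0 < k) :
    ∫ σ in Ioi (0 : ℝ), σ⁻¹ * Erf σ ^ 1 * Real.exp (-k * σ ^ 2) =
      √Real.pi / 2 * Real.arsinh (1 / √k) := by
  have hpos (t : ℝ) : 0 < k + t ^ 2 := by positivity
  calc
    _ = ∫ σ in Ioi (0 : ℝ), Real.exp (-k * σ ^ 2) *
          ∫ t in (0 : ℝ)..1, Real.exp (-(t * σ) ^ 2) := by
      refine setIntegral_congr_fun measurableSet_Ioi fun σ hσ => ?_
      have : σ ≠ 0 := ne_of_gt hσ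
      simp only [pow_one, Erf_eq_mul_integral σ]
      field_simp
    _ = ∫ t in (0 : ℝ)..1, √Real.pi / 2 * (1 / √(k + t ^ 2)) := by
      rw [setIntegral_mul_integral_exp_swap (integrableOn_exp_neg_mul_sq hk)]
      refine intervalIntegral.integral_congr fun t _ => ?_
      simp only [← setIntegral_exp_neg_mul_sq, ← Real.exp_add]
      congr 1; ext σ; ring_nf
    _ = _ := by
      rw [intervalIntegral.integral_const_mul, intervalIntegral.integral_eq_sub_of_hasDerivAt
        (f := fun t => Real.arsinh (t / √k))]
      · simp
      · intro t _
        refine (((hasDerivAt_id t).div_const (√k)).arsinh).congr_deriv ?_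
        have h1 : 1 + (t / √k) ^ 2 = (k + t ^ 2) / k := by
          rw [div_pow, Real.sq_sqrt hk.le]; field_simp
        simp only [id, h1, smul_eq_mul, Real.sqrt_div (hpos t).le]
        have := Real.sqrt_pos.2 hk
        field_simp
      · refine Continuous.intervalIntegrable ?_ _ _
        exact continuous_const.div (by fun_prop) fun t => (Real.sqrt_pos.2 (hpos t)).ne'

/-- Integrate by parts: `σ exp(-cσ²)` is the derivative of `-exp(-cσ²)/(2c)`, and `Erf'` turns the
rest into a Gaussian with parameter `c + 1`. -/
theorem setIntegral_mul_Erf_mul_exp {c : ℝ} (hc : 0 < c) :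
    ∫ σ in Ioi (0 : ℝ), Erf σ * (σ * Real.exp (-c * σ ^ 2)) =
      √Real.pi / 4 * (1 / (c * √(c + 1))) := by
  have hi := integrableOn_mul_Erf_mul_exp hc
  have hi2 := (integrableOn_exp_neg_mul_sq (by linarith : 0 < c + 1)).const_mul (1 / (2 * c))
  have h := integral_Ioi_of_hasDerivAt_of_tendsto' (a := 0) (m := 0)
    (f := fun σ => -(Erf σ * Real.exp (-c * σ ^ 2) / (2 * c)))
    (f' := fun σ => Erf σ * (σ * Real.exp (-c * σ ^ 2)) -
      1 / (2 * c) * Real.exp (-(c + 1) * σ ^ 2)) ?_ (hi.sub hi2) ?_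
  · rw [integral_sub hi hi2, integral_const_mul, setIntegral_exp_neg_mul_sq] at h
    simp only [Erf_zero, zero_mul, zero_div, neg_zero, sub_zero] at h
    rw [sub_eq_zero.1 h]
    have : 0 < √(c + 1) := Real.sqrt_pos.2 (by linarith)
    field_simp
    norm_num
  · intro σ _
    have h1 : HasDerivAt (fun σ : ℝ => Real.exp (-c * σ ^ 2))
        (Real.exp (-c * σ ^ 2) * (-c * (2 * σ))) σ := by
      simpa using ((hasDerivAt_pow 2 σ).const_mul (-c)).exp
    refine ((((hasDerivAt_Erf σ).mul h1).div_const (2 * c)).neg).congr_deriv ?_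
    have h2 : Real.exp (-(c + 1) * σ ^ 2) = Real.exp (-σ ^ 2) * Real.exp (-c * σ ^ 2) := by
      rw [← Real.exp_add]; ring_nf
    rw [h2]
    field_simp
    ring
  · have h1 : Tendsto (fun σ : ℝ => Real.exp (-c * σ ^ 2)) atTop (𝓝 0) :=
      Real.tendsto_exp_atBot.comp
        ((tendsto_pow_atTop two_ne_zero).const_mul_atTop_of_neg (by linarith))
    simpa using ((tendsto_Erf_atTop.mul h1).div_const (2 * c)).neg

/-- Expanding only one of the two `Erf` factors supplies the weight `σ` that the preceding
integration by parts needs, with `c = t² + 2`. -/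
theorem setIntegral_Erf_sq_mul_exp_two :
    ∫ σ in Ioi (0 : ℝ), Erf σ ^ 2 * Real.exp (-2 * σ ^ 2) =
      √Real.pi / 4 * (1 / √2 * Real.arctan (1 / (2 * √2))) := by
  have hpos (t : ℝ) : 0 < t ^ 2 + 3 := by positivity
  calc
    _ = ∫ σ in Ioi (0 : ℝ), Erf σ * (σ * Real.exp (-2 * σ ^ 2)) *
          ∫ t in (0 : ℝ)..1, Real.exp (-(t * σ) ^ 2) := by
      refine setIntegral_congr_fun measurableSet_Ioi fun σ hσ => ?_
      rw [sq, mul_assoc]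
      nth_rw 2 [Erf_eq_mul_integral σ]
      ring
    _ = ∫ t in (0 : ℝ)..1, √Real.pi / 4 * (1 / ((t ^ 2 + 2) * √(t ^ 2 + 3))) := by
      rw [setIntegral_mul_integral_exp_swap (integrableOn_mul_Erf_mul_exp two_pos)]
      refine intervalIntegral.integral_congr fun t _ => ?_
      have h := setIntegral_mul_Erf_mul_exp (by positivity : 0 < t ^ 2 + 2)
      rw [show t ^ 2 + 2 + 1 = t ^ 2 + 3 by ring] at h
      simp only [← h]
      congr 1; ext σ
      rw [show -(t ^ 2 + 2) * σ ^ 2 = -2 * σ ^ 2 + -(t * σ) ^ 2 by ring, Real.exp_add]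
      ring
    _ = _ := by
      rw [intervalIntegral.integral_const_mul, intervalIntegral.integral_eq_sub_of_hasDerivAt
        (f := fun t => 1 / √2 * Real.arctan (t / (√2 * √(t ^ 2 + 3))))]
      · have h4 : √((1 : ℝ) ^ 2 + 3) = 2 := by
          rw [show (1 : ℝ) ^ 2 + 3 = 2 ^ 2 by norm_num, Real.sqrt_sq zero_le_two]
        rw [h4]
        simp [mul_comm]
      · intro t _
        have hs := Real.sqrt_pos.2 (hpos t)
        have h2 : 0 < √(2 : ℝ) := by positivity
        have e2 : √(2 : ℝ) ^ 2 = 2 := Real.sq_sqrt zero_le_two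
        have hsq : √(t ^ 2 + 3) ^ 2 = t ^ 2 + 3 := Real.sq_sqrt (hpos t).le
        have hd : HasDerivAt (fun t : ℝ => t ^ 2 + 3) (2 * t) t := by
          simpa using (hasDerivAt_pow 2 t).add_const 3
        refine (((((hasDerivAt_id t).div ((hd.sqrt (hpos t).ne').const_mul (√2))
          (mul_pos h2 hs).ne').arctan).const_mul (1 / √2))).congr_deriv ?_
        simp only [id, Pi.div_apply]
        set s := √(t ^ 2 + 3)
        set r := √(2 : ℝ)
        have h3 : 1 + (t / (r * s)) ^ 2 = 3 * (t ^ 2 + 2) / (r * s) ^ 2 := by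
          rw [div_pow, mul_pow, hsq, e2]
          have := hpos t
          field_simp
          ring
        have h5 : (1 * (r * s) - t * (r * (2 * t / (2 * s)))) / (r * s) ^ 2 =
            3 * r / s / (r * s) ^ 2 := by
          congr 1
          field_simp
          rw [hsq]; ring
        rw [h3, h5]
        have : 0 < t ^ 2 + 2 := by positivity
        field_simp
      · refine Continuous.intervalIntegrable ?_ _ _
        refine continuous_const.div (by fun_prop) fun t => ?_
        have := Real.sqrt_pos.2 (hpos t)
        positivity

theorem setIntegral_Erf_sq_mul_exp_one :
    ∫ σ in Ioi (0 : ℝ), Erf σ ^ 2 * Real.exp (-1 * σ ^ 2) = (√Real.pi / 2) ^ 3 / 3 := by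
  rw [integral_Ioi_of_hasDerivAt_of_tendsto' (m := (√Real.pi / 2) ^ 3 / 3)
    (f := fun σ => Erf σ ^ 3 / 3) _ (integrableOn_Erf_pow 2 one_pos)
    ((tendsto_Erf_atTop.pow 3).div_const 3)]
  · simp
  · intro σ _
    refine (((hasDerivAt_Erf σ).pow 3).div_const 3).congr_deriv ?_
    simp
    ring

theorem arsinh_one : Real.arsinh (1 / √1) = Real.log (1 + √2) := by
  norm_num [Real.arsinh]

theorem arsinh_inv_sqrt_two :
    Real.arsinh (1 / √2) = Real.log (1 + √3) - Real.log 2 / 2 := by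
  have h2 : 0 < √(2 : ℝ) := by positivity
  have h : 1 / √2 + √(1 + (1 / √2) ^ 2) = (1 + √3) / √2 := by
    rw [div_pow, Real.sq_sqrt zero_le_two, show (1 : ℝ) + 1 ^ 2 / 2 = 3 / 2 by norm_num,
      Real.sqrt_div (by norm_num)]
    ring
  rw [Real.arsinh, h, Real.log_div (by positivity) h2.ne', Real.log_sqrt zero_le_two]

theorem arsinh_inv_sqrt_three : Real.arsinh (1 / √3) = Real.log 3 / 2 := by
  have h3 : 0 < √(3 : ℝ) := by positivity
  have h : 1 / √3 + √(1 + (1 / √3) ^ 2) = √3 := by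
    rw [div_pow, Real.sq_sqrt (by norm_num), show (1 : ℝ) + 1 ^ 2 / 3 = 2 ^ 2 / 3 by norm_num,
      Real.sqrt_div (by norm_num), Real.sqrt_sq zero_le_two]
    field_simp
    rw [Real.sq_sqrt (by norm_num)]
    norm_num
  rw [Real.arsinh, h, Real.log_sqrt (by norm_num)]

/-! ### An antiderivative of the fourth power of the kernel -/

/-- The monomial `c σ⁻ᵐ Erf(σ)ᵃ (exp (-σ²) - 1)ᵇ` with coefficient and exponents `(c, m, a, b)`. -/
noncomputable def erfMonomial (p : ℚ × ℕ × ℕ × ℕ) (σ : ℝ) : ℝ :=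
  p.1 * (σ⁻¹ ^ p.2.1 * Erf σ ^ p.2.2.1 * (Real.exp (-σ ^ 2) - 1) ^ p.2.2.2)

/-- The derivative of `erfMonomial p`. -/
noncomputable def erfMonomialDeriv (p : ℚ × ℕ × ℕ × ℕ) (σ : ℝ) : ℝ :=
  p.1 * ((-(p.2.1 : ℝ) * σ⁻¹ ^ (p.2.1 + 1) * Erf σ ^ p.2.2.1 +
      σ⁻¹ ^ p.2.1 * (p.2.2.1 * Erf σ ^ (p.2.2.1 - 1) * Real.exp (-σ ^ 2))) *
        (Real.exp (-σ ^ 2) - 1) ^ p.2.2.2 +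
    σ⁻¹ ^ p.2.1 * Erf σ ^ p.2.2.1 * (p.2.2.2 * (Real.exp (-σ ^ 2) - 1) ^ (p.2.2.2 - 1) *
      (-2 * σ * Real.exp (-σ ^ 2))))

theorem hasDerivAt_erfMonomial (p : ℚ × ℕ × ℕ × ℕ) {σ : ℝ} (hσ : σ ≠ 0) :
    HasDerivAt (erfMonomial p) (erfMonomialDeriv p σ) σ := by
  obtain ⟨c, m, a, b⟩ := p
  have h1 : HasDerivAt (fun σ : ℝ => σ⁻¹ ^ m) (-(m : ℝ) * σ⁻¹ ^ (m + 1)) σ := by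
    refine ((hasDerivAt_inv hσ).pow m).congr_deriv ?_
    rcases m with _ | m
    · simp
    · simp only [Nat.add_sub_cancel, inv_pow, pow_succ, mul_inv]
      field_simp
  have h2 : HasDerivAt (fun σ : ℝ => Real.exp (-σ ^ 2) - 1) (-2 * σ * Real.exp (-σ ^ 2)) σ := by
    refine (((hasDerivAt_pow 2 σ).neg.exp).sub_const 1).congr_deriv ?_
    simp
    ring
  exact ((h1.mul ((hasDerivAt_Erf σ).pow a)).mul (h2.pow b)).const_mul (c : ℝ)

/-- Near `0`, `Erf σ ~ σ` and `exp(-σ²) - 1 ~ -σ²`, so the monomial has order `σ ^ (a + 2b - m)`,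
and the hypothesis makes this exponent positive. -/
theorem tendsto_erfMonomial_zero {p : ℚ × ℕ × ℕ × ℕ} (hp : p.2.1 < p.2.2.1 + 2 * p.2.2.2) :
    Tendsto (erfMonomial p) (𝓝[>] 0) (𝓝 0) := by
  obtain ⟨c, m, a, b⟩ := p
  simp only at hp
  have hE : Tendsto (fun σ => σ⁻¹ * Erf σ) (𝓝[>] 0) (𝓝 1) := by
    have := (hasDerivAt_Erf 0).tendsto_slope_zero_right
    simpa using this
  have hH : Tendsto (fun σ : ℝ => (σ ^ 2)⁻¹ * (Real.exp (-σ ^ 2) - 1)) (𝓝[>] 0) (𝓝 (-1)) := by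
    have h1 : HasDerivAt (fun u : ℝ => Real.exp (-u)) (-1) 0 := by
      simpa using (hasDerivAt_neg (0 : ℝ)).exp
    have h2 : Tendsto (fun σ : ℝ => σ ^ 2) (𝓝[>] 0) (𝓝[>] 0) := by
      refine tendsto_nhdsWithin_iff.2 ⟨?_, ?_⟩
      · exact ((continuous_pow 2).tendsto' (0 : ℝ) 0 (by simp)).mono_left nhdsWithin_le_nhds
      · filter_upwards [self_mem_nhdsWithin] with σ hσ using pow_pos (mem_Ioi.1 hσ) 2
    simpa [Function.comp_def] using h1.tendsto_slope_zero_right.comp h2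
  obtain ⟨n, hn⟩ := Nat.exists_eq_add_of_lt hp
  have hid : Tendsto (fun σ : ℝ => σ ^ (n + 1)) (𝓝[>] 0) (𝓝 0) :=
    ((continuous_pow (n + 1)).tendsto' (0 : ℝ) 0 (by simp)).mono_left nhdsWithin_le_nhds
  have h := ((hid.mul ((hE.pow a).mul (hH.pow b))).const_mul (c : ℝ))
  rw [zero_mul, mul_zero] at h
  refine h.congr' ?_
  filter_upwards [self_mem_nhdsWithin] with σ hσ
  have hσ' : σ ≠ 0 := ne_of_gt hσ
  have key : σ ^ (n + 1) * (σ⁻¹ ^ a * (σ ^ 2)⁻¹ ^ b) = σ⁻¹ ^ m := by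
    have : σ ^ a * (σ ^ 2) ^ b = σ ^ m * σ ^ (n + 1) := by
      rw [← pow_mul, ← pow_add, ← pow_add, hn]; ring_nf
    rw [inv_pow, inv_pow, inv_pow, ← mul_inv, this]
    field_simp
  simp only [erfMonomial, mul_pow, ← key]
  ring

theorem tendsto_erfMonomial_atTop {p : ℚ × ℕ × ℕ × ℕ} (hp : 0 < p.2.1) :
    Tendsto (erfMonomial p) atTop (𝓝 0) := by
  have h1 : Tendsto (fun σ : ℝ => Real.exp (-σ ^ 2) - 1) atTop (𝓝 (0 - 1)) :=
    (Real.tendsto_exp_atBot.comp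
      (tendsto_neg_atTop_atBot.comp (tendsto_pow_atTop two_ne_zero))).sub_const 1
  have h := ((((tendsto_inv_atTop_zero (𝕜 := ℝ)).pow p.2.1).mul
    (tendsto_Erf_atTop.pow p.2.2.1)).mul (h1.pow p.2.2.2)).const_mul (p.1 : ℝ)
  rw [zero_pow hp.ne', zero_mul, zero_mul, mul_zero] at h
  exact h

theorem tendsto_list_sum_map_zero {ι α : Type*} {l : Filter α} {f : ι → α → ℝ} :
    ∀ L : List ι, (∀ i ∈ L, Tendsto (f i) l (𝓝 0)) →
      Tendsto (fun x => (L.map fun i => f i x).sum) l (𝓝 0)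
  | [], _ => by simpa using tendsto_const_nhds
  | i :: L, h => by
    simpa using (h i (by simp)).add
      (tendsto_list_sum_map_zero L fun j hj => h j (by simp [hj]))

theorem hasDerivAt_list_sum_map {ι : Type*} {f f' : ι → ℝ → ℝ} {x : ℝ} :
    ∀ L : List ι, (∀ i ∈ L, HasDerivAt (f i) (f' i x) x) →
      HasDerivAt (fun x => (L.map fun i => f i x).sum) (L.map fun i => f' i x).sum x
  | [], _ => by simpa using hasDerivAt_const x (0 : ℝ)
  | i :: L, h => by
    simp only [List.map_cons, List.sum_cons]
    exact (h i (by simp)).add (hasDerivAt_list_sum_map L fun j hj => h j (by simp [hj]))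

/-- The terms produced by integrating `intervalKernel σ ^ 4` by parts. -/
def boundaryTerms : List (ℚ × ℕ × ℕ × ℕ) :=
  [(-4/7, 1, 0, 1), (-26/21, 1, 0, 2), (-256/315, 1, 0, 3), (-46/315, 1, 0, 4),
   (-24/5, 1, 2, 0), (-32/5, 1, 2, 1), (-8/5, 1, 2, 2), (-4/5, 2, 1, 1), (-6/5, 2, 1, 2),
   (-2/5, 2, 1, 3), (-8/3, 2, 3, 0), (-8/3, 2, 3, 1), (-2/35, 3, 0, 2), (-4/45, 3, 0, 3),
   (-2/63, 3, 0, 4), (-8/5, 3, 2, 1), (-8/5, 3, 2, 2), (-16/3, 3, 4, 0), (-2/5, 4, 1, 2),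
   (-2/5, 4, 1, 3), (-8, 4, 3, 1), (-4/105, 5, 0, 3), (-4/105, 5, 0, 4), (-24/5, 5, 2, 2),
   (-4/3, 6, 1, 3), (-1/7, 7, 0, 4)]

/-- What remains of `intervalKernel σ ^ 4` after integration by parts. -/
noncomputable def kernelRemainder (σ : ℝ) : ℝ :=
  32 / 315 * Real.exp (-1 * σ ^ 2) + 136 / 105 * Real.exp (-2 * σ ^ 2)
    - 48 / 35 * Real.exp (-3 * σ ^ 2) - 368 / 315 * Real.exp (-4 * σ ^ 2)
    - 32 / 5 * (Erf σ ^ 2 * Real.exp (-1 * σ ^ 2)) - 32 / 5 * (Erf σ ^ 2 * Real.exp (-2 * σ ^ 2))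
    + 4 / 5 * (σ⁻¹ * Erf σ ^ 1 * Real.exp (-1 * σ ^ 2))
    + 32 / 5 * (σ⁻¹ * Erf σ ^ 1 * Real.exp (-2 * σ ^ 2))
    + 4 / 5 * (σ⁻¹ * Erf σ ^ 1 * Real.exp (-3 * σ ^ 2))
    - 16 / 3 * (σ⁻¹ * Erf σ ^ 3 * Real.exp (-1 * σ ^ 2))

theorem sum_erfMonomialDeriv_boundaryTerms {σ : ℝ} (hσ : σ ≠ 0) :
    (boundaryTerms.map fun p => erfMonomialDeriv p σ).sum =
      intervalKernel σ ^ 4 - kernelRemainder σ := by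
  have h (n : ℕ) : Real.exp (-n * σ ^ 2) = Real.exp (-σ ^ 2) ^ n := by
    rw [← Real.exp_nat_mul]; ring_nf
  have h1 := h 1
  have h2 := h 2
  have h3 := h 3
  have h4 := h 4
  push_cast at h1 h2 h3 h4
  simp only [boundaryTerms, List.map_cons, List.map_nil, List.sum_cons, List.sum_nil,
    erfMonomialDeriv, kernelRemainder, intervalKernel, h1, h2, h3, h4]
  -- With `Erf σ` and the exponential as free variables, what remains is a rational identity in `g`,
  -- `E` and `t = σ⁻¹`.
  generalize Real.exp (-σ ^ 2) = g
  generalize Erf σ = E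
  obtain ⟨t, ht⟩ : ∃ t, t = σ⁻¹ := ⟨_, rfl⟩
  have hs : σ = t⁻¹ := by simp [ht]
  have ht0 : t ≠ 0 := by simp [ht, hσ]
  subst hs
  simp only [inv_inv, div_eq_mul_inv, inv_pow]
  push_cast
  field_simp
  ring

theorem setIntegral_intervalKernel_pow_four (h : IntegrableOn kernelRemainder (Ioi 0)) :
    ∫ σ in Ioi (0 : ℝ), intervalKernel σ ^ 4 = ∫ σ in Ioi (0 : ℝ), kernelRemainder σ := by
  have hi := integrableOn_intervalKernel_pow (d := 4) (by norm_num)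
  have key := integral_Ioi_of_hasDerivAt_of_tendsto (a := 0) (m := 0)
    (f := fun σ => (boundaryTerms.map fun p => erfMonomial p σ).sum)
    (f' := fun σ => intervalKernel σ ^ 4 - kernelRemainder σ) ?_ ?_ (hi.sub h) ?_
  · rw [integral_sub hi h] at key
    -- Every term has a positive power of `σ⁻¹`, so the convention `0⁻¹ = 0` gives the value `0` at
    -- `σ = 0`, which agrees with the right-hand limit.
    have h0 : (boundaryTerms.map fun p => erfMonomial p 0).sum = 0 := by
      simp [boundaryTerms, erfMonomial]
    rw [h0, sub_zero] at key
    exact sub_eq_zero.1 key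
  · rw [← continuousWithinAt_Ioi_iff_Ici]
    have h0 : (boundaryTerms.map fun p => erfMonomial p 0).sum = 0 := by
      simp [boundaryTerms, erfMonomial]
    rw [ContinuousWithinAt, h0]
    have hd : ∀ p ∈ boundaryTerms, p.2.1 < p.2.2.1 + 2 * p.2.2.2 := by decide
    exact tendsto_list_sum_map_zero _ fun p hp => tendsto_erfMonomial_zero (hd p hp)
  · intro σ hσ
    rw [← sum_erfMonomialDeriv_boundaryTerms (ne_of_gt hσ)]
    exact hasDerivAt_list_sum_map _ fun p _ => hasDerivAt_erfMonomial p (ne_of_gt hσ)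
  · have hd : ∀ p ∈ boundaryTerms, 0 < p.2.1 := by decide
    exact tendsto_list_sum_map_zero _ fun p hp => tendsto_erfMonomial_atTop (hd p hp)

theorem hasIntegral_kernelRemainder :
    IntegrableOn kernelRemainder (Ioi 0) ∧
    ∫ σ in Ioi (0 : ℝ), kernelRemainder σ =
      32 / 315 * (√Real.pi / 2 * (1 / √1)) + 136 / 105 * (√Real.pi / 2 * (1 / √2))
      - 48 / 35 * (√Real.pi / 2 * (1 / √3)) - 368 / 315 * (√Real.pi / 2 * (1 / √4))
      - 32 / 5 * ((√Real.pi / 2) ^ 3 / 3)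
      - 32 / 5 * (√Real.pi / 4 * (1 / √2 * Real.arctan (1 / (2 * √2))))
      + 4 / 5 * (√Real.pi / 2 * Real.arsinh (1 / √1))
      + 32 / 5 * (√Real.pi / 2 * Real.arsinh (1 / √2))
      + 4 / 5 * (√Real.pi / 2 * Real.arsinh (1 / √3))
      - 16 / 3 * ∫ σ in Ioi (0 : ℝ), σ⁻¹ * Erf σ ^ 3 * Real.exp (-1 * σ ^ 2) := by
  -- Carrying integrability along with the value lets the linear combination be built one term at a
  -- time.
  have add {f g : ℝ → ℝ} {a b : ℝ} (hf : IntegrableOn f (Ioi 0) ∧ ∫ σ in Ioi (0 : ℝ), f σ = a)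
      (c : ℝ) (hg : IntegrableOn g (Ioi 0) ∧ ∫ σ in Ioi (0 : ℝ), g σ = b) :
      IntegrableOn (fun σ => f σ + c * g σ) (Ioi 0) ∧
        ∫ σ in Ioi (0 : ℝ), (f σ + c * g σ) = a + c * b := by
    refine ⟨hf.1.add (hg.1.const_mul c), ?_⟩
    rw [integral_add hf.1 (hg.1.const_mul c), integral_const_mul, hf.2, hg.2]
  have gauss (k : ℝ) (hk : 0 < k) := And.intro (integrableOn_exp_neg_mul_sq hk)
    (setIntegral_exp_neg_mul_sq (k := k))
  have inv (k : ℝ) (hk : 0 < k) := And.intro (integrableOn_inv_mul_Erf_pow_succ 0 hk)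
    (setIntegral_inv_mul_Erf hk)
  have h0 : IntegrableOn (fun _ : ℝ => (0 : ℝ)) (Ioi 0) ∧ ∫ _ in Ioi (0 : ℝ), (0 : ℝ) = 0 := by
    simp
  have h := add (add (add (add (add (add (add (add (add (add h0
    (32 / 315) (gauss 1 one_pos)) (136 / 105) (gauss 2 two_pos))
    (-(48 / 35)) (gauss 3 three_pos)) (-(368 / 315)) (gauss 4 four_pos))
    (-(32 / 5)) ⟨integrableOn_Erf_pow 2 one_pos, setIntegral_Erf_sq_mul_exp_one⟩)
    (-(32 / 5)) ⟨integrableOn_Erf_pow 2 two_pos, setIntegral_Erf_sq_mul_exp_two⟩)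
    (4 / 5) (inv 1 one_pos)) (32 / 5) (inv 2 two_pos)) (4 / 5) (inv 3 three_pos))
    (-(16 / 3)) ⟨integrableOn_inv_mul_Erf_pow_succ 2 one_pos, rfl⟩
  unfold kernelRemainder
  simpa only [neg_mul, ← sub_eq_add_neg, zero_add, Nat.reduceAdd] using h

theorem toReal_selfInteraction_four :
    (selfInteraction 4).toReal =
      -(152 / 315) + 68 * √2 / 105 - 16 * √3 / 35 - 16 * Real.log 2 / 5 + 2 * Real.log 3 / 5
        + 4 / 5 * Real.log (1 + √2) + 32 / 5 * Real.log (1 + √3) - 8 * Real.pi / 15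
        - 8 * √2 / 5 * Real.arctan (1 / (2 * √2))
        - 16 / 3 * (2 / √Real.pi *
            ∫ σ in Ioi (0 : ℝ), σ⁻¹ * Erf σ ^ 3 * Real.exp (-1 * σ ^ 2)) := by
  have hpi : 0 < √Real.pi := Real.sqrt_pos.2 Real.pi_pos
  have hsq : √Real.pi ^ 2 = Real.pi := Real.sq_sqrt Real.pi_pos.le
  have h2 : 1 / √(2 : ℝ) = √2 / 2 := by
    rw [div_eq_div_iff (by positivity) two_ne_zero, Real.mul_self_sqrt zero_le_two, one_mul]
  have h3 : 1 / √(3 : ℝ) = √3 / 3 := by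
    rw [div_eq_div_iff (by positivity) three_ne_zero, Real.mul_self_sqrt zero_le_three, one_mul]
  have h4 : √(4 : ℝ) = 2 := by
    rw [show (4 : ℝ) = 2 ^ 2 by norm_num, Real.sqrt_sq zero_le_two]
  rw [toReal_selfInteraction (by norm_num), setIntegral_intervalKernel_pow_four
    hasIntegral_kernelRemainder.1, hasIntegral_kernelRemainder.2, arsinh_one, arsinh_inv_sqrt_two,
    arsinh_inv_sqrt_three, h2, h3, h4, Real.sqrt_one]
  generalize ∫ σ in Ioi (0 : ℝ), σ⁻¹ * Erf σ ^ 3 * Real.exp (-1 * σ ^ 2) = J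
  -- With `π` written as `√π ^ 2`, the prefactor `2/√π` cancels algebraically.
  rw [← hsq]
  simp only [Real.sqrt_sq hpi.le]
  generalize Real.arctan _ = A
  field_simp
  ring

theorem mainTheorem7 :
    (∀ d : ℕ, 1 ≤ d →
      selfInteraction d =
        ∫⁻ σ in Ioi (0 : ℝ), ENNReal.ofReal
          (2 / √Real.pi * (2 * Erf σ / σ + (Real.exp (-σ ^ 2) - 1) / σ ^ 2) ^ d)) ∧
    selfInteraction 1 = ∞ ∧
    (∀ d : ℕ, 2 ≤ d →
      selfInteraction d < ∞ ∧
      IntegrableOn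
        (fun σ : ℝ => (2 * Erf σ / σ + (Real.exp (-σ ^ 2) - 1) / σ ^ 2) ^ d) (Ioi 0) ∧
      (selfInteraction d).toReal =
        2 / √Real.pi *
          ∫ σ in Ioi (0 : ℝ), (2 * Erf σ / σ + (Real.exp (-σ ^ 2) - 1) / σ ^ 2) ^ d) ∧
    IntegrableOn (fun σ : ℝ => σ⁻¹ * Real.exp (-σ ^ 2) * Erf σ ^ 3) (Ioi 0) ∧
    (selfInteraction 4).toReal =
      -(152 / 315) + 68 * √2 / 105 - 16 * √3 / 35 - 16 * Real.log 2 / 5 + 2 * Real.log 3 / 5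
        + 4 / 5 * Real.log (1 + √2) + 32 / 5 * Real.log (1 + √3) - 8 * Real.pi / 15
        - 8 * √2 / 5 * Real.arctan (1 / (2 * √2))
        - 16 / 3 * (2 / √Real.pi *
            ∫ σ in Ioi (0 : ℝ), σ⁻¹ * Real.exp (-σ ^ 2) * Erf σ ^ 3) := by
  have hJ (σ : ℝ) : σ⁻¹ * Real.exp (-σ ^ 2) * Erf σ ^ 3 =
      σ⁻¹ * Erf σ ^ 3 * Real.exp (-1 * σ ^ 2) := by
    rw [neg_one_mul]
    ring
  refine ⟨fun d _ => selfInteraction_eq_lintegral d, selfInteraction_one, fun d hd => ⟨?_,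
    integrableOn_intervalKernel_pow hd, toReal_selfInteraction hd⟩, ?_, ?_⟩
  · rw [selfInteraction_eq_ofReal hd]
    exact ENNReal.ofReal_lt_top
  · simp only [hJ]
    exact integrableOn_inv_mul_Erf_pow_succ 2 one_pos
  · simp only [hJ]
    exact toReal_selfInteraction_four
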